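/- A parallelohedron in $\mathbb{R}^2$ is a convex polygon $P$ (the convex hull of finitely many points, with non-empty interior) such that some family of translates $(t+P)_{t\in T}$, $T\subset\mathbb{R}^2$, tiles $\mathbb{R}^2$ face-to-face: the translates cover $\mathbb{R}^2$, their interiors are pairwise disjoint, and any two distinct translates are either disjoint or meet in a common face of both. Let $P$ be a parallelohedron in $\mathbb{R}^2$ that is symmetric about the origin ($-P=P$), and let $\|x\|_P=\inf\{\lambda\ge 0 : x\in\lambda P\}$ be the norm whose unit ball is $P$. Let $G(\mathbb{R}^2,\|\cdot\|_P)$ be the graph whose vertices are the points of $\mathbb{R}^2$ and in which $x$ and $y$ are adjacent if and only if $\|x-y\|_P=1$. Then the chromatic number of $G(\mathbb{R}^2,\|\cdot\|_P)$ is exactly $4$. -/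

import Mathlib

open scoped Pointwise

/-- A (convex) polytope: the convex hull of finitely many points. -/
def IsPolytope {E : Type*} [AddCommGroup E] [Module ℝ E] (P : Set E) : Prop :=
  ∃ s : Set E, s.Finite ∧ P = convexHull ℝ s

/-- The translates `t + P`, `t ∈ T`, form a face-to-face tiling of the space: they cover it, their
interiors are pairwise disjoint, and two distinct translates meet, if at all, in a common face.
(`IsExposed ℝ A B` says that `B` is empty or the set of maximisers on `A` of a continuous linear
functional; for a polytope `A`, these are exactly its faces.) -/
structure IsFaceToFaceTiling {E : Type*} [AddCommGroup E] [Module ℝ E] [TopologicalSpace E]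
    (P T : Set E) : Prop where
  cover : ⋃ t ∈ T, (t +ᵥ P) = Set.univ
  disjoint_interior : ∀ t ∈ T, ∀ u ∈ T, t ≠ u →
    Disjoint (t +ᵥ interior P) (u +ᵥ interior P)
  common_face : ∀ t ∈ T, ∀ u ∈ T, t ≠ u →
    IsExposed ℝ (t +ᵥ P) ((t +ᵥ P) ∩ (u +ᵥ P)) ∧
    IsExposed ℝ (u +ᵥ P) ((t +ᵥ P) ∩ (u +ᵥ P))

/-- A parallelohedron: a full-dimensional polytope that admits a face-to-face tiling of the space
by translates. -/
structure IsParallelohedron {E : Type*} [AddCommGroup E] [Module ℝ E] [TopologicalSpace E]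
    (P : Set E) : Prop where
  polytope : IsPolytope P
  interior_nonempty : (interior P).Nonempty
  exists_tiling : ∃ T : Set E, IsFaceToFaceTiling P T

/-- For a set `P` symmetric about the origin, the unit distance graph of `‖·‖_P`, where
`‖x‖_P = inf {r > 0 | x ∈ r P}` is the gauge of `P`: the vertices are the points of the space,
and `x`, `y` are joined when `‖x - y‖_P = 1`. -/
def unitDistanceGraph {E : Type*} [AddCommGroup E] [Module ℝ E] (P : Set E)
    (hsymm : ∀ x ∈ P, -x ∈ P) : SimpleGraph E where
  Adj x y := gauge P (x - y) = 1
  symm := ⟨fun x y h => by rw [← neg_sub, gauge_neg hsymm]; exact h⟩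
  loopless := ⟨fun x h => by simp at h⟩

/-!
Write `p` for the norm with unit ball `P`. The proof brings `p` to a normal form and settles the
chromatic number there by explicit constructions.

*Normal form.* Call `t` a facet vector if `P` and `t + P` share an edge. The midpoint `t / 2` of that
edge lies in no other proper face of `P`, so in every face-to-face tiling by translates of `P` the
tile across this edge is the translate by `t` (`IsFacetVector.eq_of_half_smul_mem`). A tiling is therefore invariant
under the lattice generated by the facet vectors, which is discrete and so generated by two vectors
(`IsBallTiling.exists_generators`). If two facet vectors are congruent modulo twice this lattice, then
half their difference is zero or a centre of a tile through the midpoint of an edge, and the two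
vectors agree up to sign (`IsBallTiling.eq_or_eq_neg_of_sub_eq_two_smul`). There are at most
three nonzero classes modulo twice the lattice, so `P` has at most three pairs of opposite edges, and `p` is the
maximum of the absolute values of three linear functionals (`IsBallTiling.exists_functionals`). In
suitable coordinates `p` is `max |x| |y| |a x + b y|` with `0 < b ≤ a ≤ 1 ≤ a + b`
(`exists_equiv_hexGauge`).

*Four colours.* The hexagon `max |x| |y| |a x + b y| ≤ 1` is a Voronoi cell of an explicit lattice
`Λ` for a suitable quadratic form, so its translates by `Λ` tile the plane. Colour the cells of the
tiling scaled by `1 / 2` by the classes of `Λ` modulo `2 Λ`. Differences of points in open cells of one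
colour lie in an open tile of the original tiling, and an open tile contains no vector of norm `1`
(`InCellOfColor.hexGauge_sub_ne_one`). To give colours to the points on the cell boundaries too, every
point is coloured as its generic translates are, along an ultrafilter (`exists_coloring_of_hexGauge`).

*Three colours do not suffice.* If `u`, `v` and `v - u` have norm `1`, a proper colouring with three
colours gives `u + v` the colour of `0`. For suitable pairs `(u, v)` and `(u', v')` of this kind the
vector `u + v - u' - v'` has norm `1` (`not_exists_three_coloring_of_hexGauge`).
-/

/-! ### The hexagonal norms of the coordinate plane -/

/-- The norm on `ℝ × ℝ` whose unit ball is the hexagon cut out by `|x| ≤ 1`, `|y| ≤ 1` and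
`|a x + b y| ≤ 1`; for `a + b = 1` the third condition is redundant and the ball is a square. -/
def hexGauge (a b : ℝ) (v : ℝ × ℝ) : ℝ := max |v.1| (max |v.2| |a * v.1 + b * v.2|)

/-- The vector `s t₁ + r t₂`, where `t₁` and `t₂` are the doubled centres of the sides on `x = 1` and
`y = 1` of the unit hexagon of `hexGauge a b`. The integer combinations form the lattice by which the
hexagon tiles the plane. -/
noncomputable def hexVec (a b s r : ℝ) : ℝ × ℝ :=
  (2 * s + (1 - a - b) / a * r, (1 - a - b) / b * s + 2 * r)

lemma hexGauge_le_iff {a b c : ℝ} {v : ℝ × ℝ} :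
    hexGauge a b v ≤ c ↔ |v.1| ≤ c ∧ |v.2| ≤ c ∧ |a * v.1 + b * v.2| ≤ c := by
  simp [hexGauge]

lemma continuous_hexGauge (a b : ℝ) : Continuous (hexGauge a b) := by
  unfold hexGauge; fun_prop

lemma hexGauge_smul (a b c : ℝ) (v : ℝ × ℝ) : hexGauge a b (c • v) = |c| * hexGauge a b v := by
  have h : a * (c * v.1) + b * (c * v.2) = c * (a * v.1 + b * v.2) := by ring
  simp only [hexGauge, Prod.smul_fst, Prod.smul_snd, smul_eq_mul, h, abs_mul,
    mul_max_of_nonneg _ _ (abs_nonneg c)]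

lemma hexGauge_add_le (a b : ℝ) (u v : ℝ × ℝ) :
    hexGauge a b (u + v) ≤ hexGauge a b u + hexGauge a b v := by
  obtain ⟨h1, h2, h3⟩ := hexGauge_le_iff.1 (le_refl (hexGauge a b u))
  obtain ⟨k1, k2, k3⟩ := hexGauge_le_iff.1 (le_refl (hexGauge a b v))
  rw [hexGauge_le_iff]
  refine ⟨(abs_add_le _ _).trans (add_le_add h1 k1), (abs_add_le _ _).trans (add_le_add h2 k2), ?_⟩
  have : a * (u + v).1 + b * (u + v).2 = (a * u.1 + b * u.2) + (a * v.1 + b * v.2) := by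
    simp only [Prod.fst_add, Prod.snd_add]; ring
  rw [this]
  exact (abs_add_le _ _).trans (add_le_add h3 k3)

lemma hexGauge_neg (a b : ℝ) (v : ℝ × ℝ) : hexGauge a b (-v) = hexGauge a b v := by
  simpa using hexGauge_smul a b (-1) v

lemma hexVec_sub (a b s r s' r' : ℝ) :
    hexVec a b s r - hexVec a b s' r' = hexVec a b (s - s') (r - r') := by
  ext <;> simp only [hexVec, Prod.fst_sub, Prod.snd_sub] <;> ring

/-- The hexagon in lattice coordinates. With `l`, `m`, `n` the three (nonnegative) Selling parameters,
so that `a = l + m`, `b = l + n` and `1 = m + n`, it is the Voronoi cell of `ℤ²` for the quadratic form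
`l (s - r)² + m s² + n r²`. -/
lemma hexGauge_hexVec_le_iff {a b l m c s r : ℝ} (ha : 0 < a) (hb : 0 < b) (hal : a = l + m)
    (hbl : b = l + (1 - m)) : hexGauge a b (hexVec a b s r) ≤ c ↔
      |l * (s - r) + m * s| ≤ c * a / 2 ∧ |l * (r - s) + (1 - m) * r| ≤ c * b / 2 ∧
        |m * s + (1 - m) * r| ≤ c / 2 := by
  have e1 : l * (s - r) + m * s = a * (hexVec a b s r).1 / 2 := by
    simp only [hexVec]; field_simp; subst hal; subst hbl; ring
  have e2 : l * (r - s) + (1 - m) * r = b * (hexVec a b s r).2 / 2 := by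
    simp only [hexVec]; field_simp; subst hal; subst hbl; ring
  have e3 : m * s + (1 - m) * r = (a * (hexVec a b s r).1 + b * (hexVec a b s r).2) / 2 := by
    simp only [hexVec]; field_simp; subst hal; subst hbl; ring
  rw [hexGauge_le_iff, e1, e2, e3]
  simp only [abs_div, abs_mul, abs_of_pos ha, abs_of_pos hb, abs_two,
    div_le_div_iff_of_pos_right (zero_lt_two' ℝ)]
  rw [mul_comm c a, mul_comm c b, mul_le_mul_iff_right₀ ha, mul_le_mul_iff_right₀ hb]

lemma exists_hexVec {a b : ℝ} (hb : 0 < b) (hba : b ≤ a) (ha1 : a ≤ 1) (hab : 1 ≤ a + b)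
    (v : ℝ × ℝ) : ∃ s r, v = hexVec a b s r := by
  have ha : 0 < a := hb.trans_le hba
  -- Cramer's rule; `d` is `a b` times the determinant of `(t₁, t₂)`.
  obtain ⟨d, hd⟩ : ∃ d, d = 4 * a * b - (1 - a - b) ^ 2 := ⟨_, rfl⟩
  have hd0 : d ≠ 0 := by
    have : 0 < d := by nlinarith
    exact this.ne'
  refine ⟨(2 * a * b * v.1 - b * (1 - a - b) * v.2) / d,
    (2 * a * b * v.2 - a * (1 - a - b) * v.1) / d, ?_⟩
  ext <;> simp only [hexVec] <;> field_simp <;> rw [hd] <;> ring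

/-- The triangle with vertices `(0, 0)`, `(1, 0)`, `(1, 1)` is covered by the cells centred at its
vertices: a point lies in the cell of the vertex nearest for the quadratic form. -/
lemma mem_cell_of_mem_triangle {l m s r : ℝ} (hl : 0 ≤ l) (hm : 0 < m) (hm1 : m < 1)
    (hr : 0 ≤ r) (hrs : r ≤ s) (hs : s ≤ 1) :
    ∃ i j : ℤ, |l * ((s - i) - (r - j)) + m * (s - i)| ≤ (l + m) / 2 ∧
      |l * ((r - j) - (s - i)) + (1 - m) * (r - j)| ≤ (l + (1 - m)) / 2 ∧
      |m * (s - i) + (1 - m) * (r - j)| ≤ 1 / 2 := by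
  have h1 : 0 ≤ l * (s - r) := mul_nonneg hl (by linarith)
  have h2 : 0 ≤ l * (1 - (s - r)) := mul_nonneg hl (by linarith)
  have h3 : 0 ≤ m * s := mul_nonneg hm.le (by linarith)
  have h4 : 0 ≤ m * (1 - s) := mul_nonneg hm.le (by linarith)
  have h5 : 0 ≤ (1 - m) * r := mul_nonneg (by linarith) hr
  have h6 : 0 ≤ (1 - m) * (1 - r) := mul_nonneg (by linarith) (by linarith)
  by_cases c1 : l * (s - r) + m * s ≤ (l + m) / 2
  · by_cases c2 : m * s + (1 - m) * r ≤ 1 / 2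
    · have k1 : r ≤ 1 / 2 := by nlinarith
      have k2 : s - r ≤ 1 / 2 := by
        by_contra! h
        nlinarith
      refine ⟨0, 0, ?_⟩
      simp only [abs_le, Int.cast_zero, sub_zero]
      refine ⟨⟨?_, ?_⟩, ⟨?_, ?_⟩, ?_, ?_⟩ <;> nlinarith
    · push Not at c2
      have k1 : 1 / 2 ≤ s := by nlinarith
      have c3 : (l + (1 - m)) / 2 < l * (1 - (s - r)) + (1 - m) * r := by nlinarith
      have k2 : s - r ≤ 1 / 2 := by
        by_contra! h
        nlinarith
      refine ⟨1, 1, ?_⟩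
      simp only [abs_le, Int.cast_one]
      refine ⟨⟨?_, ?_⟩, ⟨?_, ?_⟩, ?_, ?_⟩ <;> nlinarith
  · push Not at c1
    by_cases c3 : l * (1 - (s - r)) + (1 - m) * r ≤ (l + (1 - m)) / 2
    · have k1 : 1 / 2 ≤ s := by
        by_contra! h
        nlinarith
      have k2 : r ≤ 1 / 2 := by
        by_contra! h
        nlinarith
      refine ⟨1, 0, ?_⟩
      simp only [abs_le, Int.cast_one, Int.cast_zero, sub_zero]
      refine ⟨⟨?_, ?_⟩, ⟨?_, ?_⟩, ?_, ?_⟩ <;> nlinarith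
    · push Not at c3
      have c2 : 1 / 2 < m * s + (1 - m) * r := by nlinarith
      have k1 : 1 / 2 ≤ s := by nlinarith
      have k2 : 1 / 2 ≤ r ∨ s - r ≤ 1 / 2 := by
        by_contra! h
        nlinarith
      refine ⟨1, 1, ?_⟩
      simp only [abs_le, Int.cast_one]
      refine ⟨⟨?_, ?_⟩, ⟨?_, ?_⟩, ?_, ?_⟩ <;> nlinarith

lemma exists_int_mem_cell {l m : ℝ} (hl : 0 ≤ l) (hm : 0 < m) (hm1 : m < 1) (s r : ℝ) :
    ∃ i j : ℤ, |l * ((s - i) - (r - j)) + m * (s - i)| ≤ (l + m) / 2 ∧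
      |l * ((r - j) - (s - i)) + (1 - m) * (r - j)| ≤ (l + (1 - m)) / 2 ∧
      |m * (s - i) + (1 - m) * (r - j)| ≤ 1 / 2 := by
  have key : ∀ s r : ℝ, ∀ m, 0 < m → m < 1 → Int.fract r ≤ Int.fract s →
      ∃ i j : ℤ, |l * ((s - i) - (r - j)) + m * (s - i)| ≤ (l + m) / 2 ∧
        |l * ((r - j) - (s - i)) + (1 - m) * (r - j)| ≤ (l + (1 - m)) / 2 ∧
        |m * (s - i) + (1 - m) * (r - j)| ≤ 1 / 2 := by
    intro s r m hm hm1 h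
    obtain ⟨i, j, hij⟩ := mem_cell_of_mem_triangle hl hm hm1 (Int.fract_nonneg r) h
      (Int.fract_lt_one s).le
    refine ⟨⌊s⌋ + i, ⌊r⌋ + j, ?_⟩
    simpa only [Int.cast_add, ← sub_sub, Int.self_sub_floor] using hij
  rcases le_total (Int.fract r) (Int.fract s) with h | h
  · exact key s r m hm hm1 h
  · obtain ⟨i, j, h1, h2, h3⟩ := key r s (1 - m) (by linarith) (by linarith) h
    rw [sub_sub_cancel] at h2 h3
    exact ⟨j, i, h2, h1, by rwa [add_comm]⟩

/-- The lattice translates of the unit hexagon cover the plane. -/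
lemma exists_hexGauge_sub_hexVec_le {a b : ℝ} (hb : 0 < b) (hba : b ≤ a) (ha1 : a ≤ 1)
    (hab : 1 ≤ a + b) (v : ℝ × ℝ) : ∃ i j : ℤ, hexGauge a b (v - hexVec a b i j) ≤ 1 := by
  obtain ⟨s, r, rfl⟩ := exists_hexVec hb hba ha1 hab v
  obtain ⟨i, j, h1, h2, h3⟩ := exists_int_mem_cell (l := (a + b - 1) / 2) (m := (1 + a - b) / 2)
    (by linarith) (by linarith) (by linarith) s r
  refine ⟨i, j, ?_⟩
  rw [hexVec_sub, hexGauge_hexVec_le_iff (l := (a + b - 1) / 2) (m := (1 + a - b) / 2)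
    (hb.trans_le hba) hb (by ring) (by ring)]
  refine ⟨h1.trans (by linarith), h2.trans (by linarith), h3⟩

/-- The nonzero lattice vectors have norm at least `2`: the translates of the unit hexagon by the
lattice have disjoint interiors. -/
lemma two_le_hexGauge_hexVec {a b : ℝ} (hb : 0 < b) (hba : b ≤ a) (ha1 : a ≤ 1)
    (hab : 1 ≤ a + b) {i j : ℤ} (hij : i ≠ 0 ∨ j ≠ 0) : 2 ≤ hexGauge a b (hexVec a b i j) := by
  by_contra! h
  obtain ⟨c, hc, hc2⟩ := exists_between h
  obtain ⟨h1, h2, h3⟩ := (hexGauge_hexVec_le_iff (l := (a + b - 1) / 2) (m := (1 + a - b) / 2)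
    (hb.trans_le hba) hb (by ring) (by ring)).1 hc.le
  have ha := hb.trans_le hba
  rw [abs_le] at h1 h2 h3
  have hca : c * a < 2 * a := by nlinarith
  have hcb : c * b < 2 * b := by nlinarith
  -- In each of the six sectors of the lattice cut out by the signs of `i`, `j` and `i - j`, one of the
  -- three linear forms is too large.
  have A : ∀ x y : ℤ, 1 ≤ x → 1 ≤ y → ∀ l m : ℝ, 0 ≤ l → 0 ≤ m → l + m ≤ l * y + m * x := by
    intro x y hx hy l m hl hm
    have : (1 : ℝ) ≤ x := by exact_mod_cast hx
    have : (1 : ℝ) ≤ y := by exact_mod_cast hy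
    nlinarith
  have hl : 0 ≤ (a + b - 1) / 2 := by linarith
  have hm : 0 ≤ (1 + a - b) / 2 := by linarith
  have hn : 0 ≤ 1 - (1 + a - b) / 2 := by linarith
  have n1 : ¬ (1 ≤ i ∧ 1 ≤ i - j) := fun h => by
    have := A _ _ h.1 h.2 _ _ hl hm
    push_cast at this; linarith
  have n2 : ¬ (1 ≤ -i ∧ 1 ≤ j - i) := fun h => by
    have := A _ _ h.1 h.2 _ _ hl hm
    push_cast at this; linarith
  have n3 : ¬ (1 ≤ j ∧ 1 ≤ j - i) := fun h => by
    have := A _ _ h.1 h.2 _ _ hl hn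
    push_cast at this; linarith
  have n4 : ¬ (1 ≤ -j ∧ 1 ≤ i - j) := fun h => by
    have := A _ _ h.1 h.2 _ _ hl hn
    push_cast at this; linarith
  have n5 : ¬ (1 ≤ i ∧ 1 ≤ j) := fun h => by
    have := A _ _ h.1 h.2 _ _ hn hm
    linarith
  have n6 : ¬ (1 ≤ -i ∧ 1 ≤ -j) := fun h => by
    have := A _ _ h.1 h.2 _ _ hn hm
    push_cast at this; linarith
  omega

/-! ### Four colours suffice for a hexagonal norm -/

/-- `v` is in the interior of a cell of the half-size tiling whose lattice index has parity `c`. -/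
def InCellOfColor (a b : ℝ) (v : ℝ × ℝ) (c : ZMod 2 × ZMod 2) : Prop :=
  ∃ i j : ℤ, ((i : ZMod 2), (j : ZMod 2)) = c ∧ hexGauge a b ((2 : ℝ) • v - hexVec a b i j) < 1

/-- No two points in open cells of the same colour are at distance `1`: their difference is within
distance less than `1` of a lattice vector `k`, which excludes `k = 0`, and `k ≠ 0` has norm at
least `2`. -/
lemma InCellOfColor.hexGauge_sub_ne_one {a b : ℝ} (hb : 0 < b) (hba : b ≤ a) (ha1 : a ≤ 1)
    (hab : 1 ≤ a + b) {u v : ℝ × ℝ} {c : ZMod 2 × ZMod 2} (hu : InCellOfColor a b u c)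
    (hv : InCellOfColor a b v c) : hexGauge a b (u - v) ≠ 1 := by
  obtain ⟨i, j, hc, hu⟩ := hu
  obtain ⟨i', j', rfl, hv⟩ := hv
  intro h
  rw [Prod.mk.injEq, ZMod.intCast_eq_intCast_iff_dvd_sub, ZMod.intCast_eq_intCast_iff_dvd_sub] at hc
  obtain ⟨⟨p, hp⟩, ⟨q, hq⟩⟩ := hc
  have hi : (i : ℝ) = i' - 2 * p := by
    have : i = i' - 2 * p := by push_cast at hp; linarith
    exact_mod_cast this
  have hj : (j : ℝ) = j' - 2 * q := by
    have : j = j' - 2 * q := by push_cast at hq; linarith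
    exact_mod_cast this
  have e : (2 : ℝ) • (u - v + hexVec a b p q) =
      ((2 : ℝ) • u - hexVec a b i j) + -((2 : ℝ) • v - hexVec a b i' j') := by
    ext <;> (simp [hexVec, hi, hj]; ring)
  have h1 : hexGauge a b (u - v + hexVec a b p q) < 1 := by
    have := hexGauge_add_le a b ((2 : ℝ) • u - hexVec a b i j) (-((2 : ℝ) • v - hexVec a b i' j'))
    rw [← e, hexGauge_smul, hexGauge_neg, abs_two] at this
    linarith
  by_cases hpq : p ≠ 0 ∨ q ≠ 0
  · have h2 := two_le_hexGauge_hexVec hb hba ha1 hab hpq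
    have h3 := hexGauge_add_le a b (u - v + hexVec a b p q) (-(u - v))
    rw [hexGauge_neg, h, show u - v + hexVec a b p q + -(u - v) = hexVec a b p q by abel] at h3
    linarith
  · push Not at hpq
    have : hexVec a b (p : ℝ) (q : ℝ) = 0 := by simp [hexVec, hpq.1, hpq.2]
    rw [this, add_zero, h] at h1
    exact lt_irrefl _ h1

lemma eventually_residual_exists_inCellOfColor {a b : ℝ} (hb : 0 < b) (hba : b ≤ a) (ha1 : a ≤ 1)
    (hab : 1 ≤ a + b) (v : ℝ × ℝ) :
    ∀ᶠ w in residual (ℝ × ℝ), ∃ c, InCellOfColor a b (v + w) c := by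
  refine residual_of_dense_open ?_ ?_
  · have : {w | ∃ c, InCellOfColor a b (v + w) c} =
        ⋃ i : ℤ, ⋃ j : ℤ, {w | hexGauge a b ((2 : ℝ) • (v + w) - hexVec a b i j) < 1} := by
      ext w
      simp [InCellOfColor]
    rw [this]
    refine isOpen_iUnion fun i => isOpen_iUnion fun j => isOpen_lt ?_ continuous_const
    exact (continuous_hexGauge a b).comp (by fun_prop)
  · intro w
    obtain ⟨i, j, hij⟩ := exists_hexGauge_sub_hexVec_le hb hba ha1 hab ((2 : ℝ) • (v + w))
    -- Points of the closed cell are approached by contracting towards its centre.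
    set d := (2 : ℝ) • (v + w) - hexVec a b i j with hd
    have ht : Filter.Tendsto (fun ε : ℝ => w - (ε / 2) • d) (nhdsWithin 0 (Set.Ioo 0 1)) (nhds w) := by
      have : Continuous fun ε : ℝ => w - (ε / 2) • d := by fun_prop
      simpa using (this.tendsto 0).mono_left nhdsWithin_le_nhds
    have : (nhdsWithin (0 : ℝ) (Set.Ioo 0 1)).NeBot := by
      rw [← mem_closure_iff_nhdsWithin_neBot, closure_Ioo zero_ne_one]
      simp
    refine mem_closure_of_tendsto ht ?_
    filter_upwards [self_mem_nhdsWithin] with ε hε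
    refine ⟨_, i, j, rfl, ?_⟩
    have e : (2 : ℝ) • (v + (w - (ε / 2) • d)) - hexVec a b i j = (1 - ε) • d := by
      rw [hd]; module
    rw [e, hexGauge_smul, abs_of_pos (by linarith [hε.2])]
    nlinarith [hε.1, hε.2]

/-- The plane with a hexagonal norm can be coloured with four colours, no two points at distance `1`
getting the same one. A point is given the colour of the cells into which it falls under almost every
small translation, in the sense of an ultrafilter containing the dense open sets; this settles the
colours of the points on the cell boundaries consistently. -/
lemma exists_coloring_of_hexGauge {a b : ℝ} (hb : 0 < b) (hba : b ≤ a) (ha1 : a ≤ 1)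
    (hab : 1 ≤ a + b) : ∃ c : ℝ × ℝ → ZMod 2 × ZMod 2,
      ∀ u v, hexGauge a b (u - v) = 1 → c u ≠ c v := by
  have : (residual (ℝ × ℝ)).NeBot := by
    refine Filter.neBot_iff.2 fun h => ?_
    have := (dense_of_mem_residual (X := ℝ × ℝ) (s := ∅) (by rw [h]; trivial)).nonempty
    simp at this
  have key : ∀ v, ∃ c, ∀ᶠ w in (Ultrafilter.of (residual (ℝ × ℝ)) : Filter (ℝ × ℝ)),
      InCellOfColor a b (v + w) c := fun v =>
    Ultrafilter.eventually_exists_iff.1 (Ultrafilter.of_le (residual (ℝ × ℝ))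
      (eventually_residual_exists_inCellOfColor hb hba ha1 hab v))
  choose c hc using key
  refine ⟨c, fun u v huv h => ?_⟩
  obtain ⟨w, hu, hv⟩ := ((hc u).and (hc v)).exists
  rw [h] at hu
  refine hu.hexGauge_sub_ne_one hb hba ha1 hab hv ?_
  rwa [add_sub_add_right_eq_sub]

/-! ### Three colours do not suffice for a hexagonal norm -/

/-- Two equilateral unit triangles with a common side: the two opposite vertices have the same colour
in a proper colouring with three colours. -/
lemma color_add_add_eq {V : Type*} [AddCommGroup V] {N : V → ℝ} {f : V → Fin 3}
    (hf : ∀ u v, N (u - v) = 1 → f u ≠ f v) {u v : V} (hu : N u = 1) (hv : N v = 1)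
    (huv : N (v - u) = 1) : f (u + v) = f 0 := by
  have h1 : f u ≠ f 0 := hf _ _ (by simpa using hu)
  have h2 : f v ≠ f 0 := hf _ _ (by simpa using hv)
  have h3 : f v ≠ f u := hf _ _ huv
  have h4 : f (u + v) ≠ f u := hf _ _ (by simpa using hv)
  have h5 : f (u + v) ≠ f v := hf _ _ (by simpa using hu)
  omega

lemma hexGauge_mk_eq_one {a b x y : ℝ} (hx : |x| ≤ 1) (hy : |y| ≤ 1) (hxy : |a * x + b * y| ≤ 1)
    (h : |x| = 1 ∨ |y| = 1 ∨ |a * x + b * y| = 1) : hexGauge a b (x, y) = 1 := by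
  refine le_antisymm (hexGauge_le_iff.2 ⟨hx, hy, hxy⟩) ?_
  simp only [hexGauge, le_max_iff]
  rcases h with h | h | h <;> simp [h]

/-- A spindle: two rhombi of equilateral unit triangles with a common vertex, whose opposite vertices
are at distance `1`. -/
lemma not_exists_three_coloring_of_hexGauge {a b : ℝ} (hb : 0 < b) (hba : b ≤ a) (ha1 : a ≤ 1)
    (hab : 1 ≤ a + b) (f : ℝ × ℝ → Fin 3) (hf : ∀ u v, hexGauge a b (u - v) = 1 → f u ≠ f v) :
    False := by
  have ha : 0 < a := hb.trans_le hba
  -- A one-parameter family of equilateral triangles; the fourth vertex of the rhombus on it is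
  -- `(1 + (1 - b * (1 + t)) / a, 1 + 2 * t)`.
  have tri : ∀ t : ℝ, -1 ≤ t → t ≤ 0 → 1 - a - b ≤ b * t → b * t ≤ 1 - b → -a ≤ b * t →
      b * t ≤ 1 - a → f (1 + (1 - b * (1 + t)) / a, 1 + 2 * t) = f 0 := by
    intro t h1 h2 h3 h4 h5 h6
    have e : ((1 + (1 - b * (1 + t)) / a, 1 + 2 * t) : ℝ × ℝ) =
        (1, t) + ((1 - b * (1 + t)) / a, 1 + t) := by
      ext
      · simp
      · simp; ring
    have k0 : 0 ≤ (1 - b * (1 + t)) / a := div_nonneg (by linarith) ha.le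
    have k1 : (1 - b * (1 + t)) / a ≤ 1 := (div_le_one ha).2 (by linarith)
    have k2 : a * ((1 - b * (1 + t)) / a) = 1 - b * (1 + t) := by field_simp
    rw [e]
    refine color_add_add_eq hf ?_ ?_ ?_
    · refine hexGauge_mk_eq_one ?_ ?_ ?_ (Or.inl abs_one) <;> rw [abs_le] <;>
        constructor <;> linarith
    · refine hexGauge_mk_eq_one ?_ ?_ ?_ (Or.inr (Or.inr ?_))
      · rw [abs_le]; constructor <;> linarith
      · rw [abs_le]; constructor <;> linarith
      all_goals rw [k2]; simp
    · rw [Prod.mk_sub_mk, add_sub_cancel_right]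
      refine hexGauge_mk_eq_one ?_ ?_ ?_ (Or.inr (Or.inl abs_one)) <;> rw [abs_le] <;>
        constructor <;> linarith
  have hA := tri ((1 - a - b) / b) (by rw [le_div_iff₀ hb]; linarith)
    (div_nonpos_of_nonpos_of_nonneg (by linarith) hb.le) (by rw [mul_div_cancel₀ _ hb.ne'])
    (by rw [mul_div_cancel₀ _ hb.ne']; linarith) (by rw [mul_div_cancel₀ _ hb.ne']; linarith)
    (by rw [mul_div_cancel₀ _ hb.ne']; linarith)
  rcases le_total (2 * a + b) 2 with h | h
  · -- The other rhombus is `0, (1, 0), (1, 1), (0, 1)`.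
    have hC : f ((1, 0) + (0, 1)) = f 0 := by
      refine color_add_add_eq hf ?_ ?_ ?_
      · refine hexGauge_mk_eq_one ?_ ?_ ?_ (Or.inl abs_one) <;> rw [abs_le] <;>
          constructor <;> linarith
      · refine hexGauge_mk_eq_one ?_ ?_ ?_ (Or.inr (Or.inl abs_one)) <;> rw [abs_le] <;>
          constructor <;> linarith
      · rw [Prod.mk_sub_mk, sub_zero]
        refine hexGauge_mk_eq_one ?_ ?_ ?_ (Or.inr (Or.inl abs_one)) <;> rw [abs_le] <;>
          constructor <;> linarith
    refine hf _ _ ?_ (hA.trans hC.symm)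
    have e : ((1 + (1 - b * (1 + (1 - a - b) / b)) / a, 1 + 2 * ((1 - a - b) / b)) : ℝ × ℝ) -
        ((1, 0) + (0, 1)) = (1, 2 * ((1 - a - b) / b)) := by
      ext
      · simp; field_simp; ring
      · simp
    have k : b * ((1 - a - b) / b) = 1 - a - b := mul_div_cancel₀ _ hb.ne'
    have k1 : 2 * ((1 - a - b) / b) ≤ 0 := by
      have := div_nonpos_of_nonpos_of_nonneg (show 1 - a - b ≤ 0 by linarith) hb.le
      linarith
    have k2 : -1 ≤ 2 * ((1 - a - b) / b) := by
      have : (-1 / 2 : ℝ) ≤ (1 - a - b) / b := by rw [le_div_iff₀ hb]; linarith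
      linarith
    rw [e]
    refine hexGauge_mk_eq_one ?_ ?_ ?_ (Or.inl abs_one) <;> rw [abs_le] <;>
        constructor <;> linarith
  · -- The other rhombus belongs to the parameter increased by `1 / 2`.
    have k : b * ((1 - a - b) / b + 1 / 2) = 1 - a - b / 2 := by field_simp; ring
    have hC := tri ((1 - a - b) / b + 1 / 2)
      (by
        have : -1 ≤ (1 - a - b) / b := by rw [le_div_iff₀ hb]; linarith
        linarith)
      (by
        have : (1 - a - b) / b ≤ -1 / 2 := by rw [div_le_iff₀ hb]; linarith
        linarith)
      (by linarith) (by linarith) (by linarith) (by linarith)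
    refine hf _ _ ?_ (hC.trans hA.symm)
    have e : ((1 + (1 - b * (1 + ((1 - a - b) / b + 1 / 2))) / a,
          1 + 2 * ((1 - a - b) / b + 1 / 2)) : ℝ × ℝ) -
        (1 + (1 - b * (1 + (1 - a - b) / b)) / a, 1 + 2 * ((1 - a - b) / b)) =
        (-(b / (2 * a)), 1) := by
      ext
      · simp; field_simp; ring
      · simp; ring
    have k0 : 0 ≤ b / (2 * a) := by positivity
    have k1 : b / (2 * a) ≤ 1 := by rw [div_le_one (by positivity)]; linarith
    have k2 : a * (b / (2 * a)) = b / 2 := by field_simp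
    rw [e]
    refine hexGauge_mk_eq_one ?_ ?_ ?_ (Or.inr (Or.inl abs_one)) <;> rw [abs_le] <;>
        constructor <;> linarith

/-! ### Tilings by unit balls of a norm -/

/-- The intersection of the unit ball of `p` with its translate by `t`. -/
def commonFace {E : Type*} [AddCommGroup E] [Module ℝ E] (p : Seminorm ℝ E) (t : E) : Set E :=
  {x | p x ≤ 1 ∧ p (x - t) ≤ 1}

/-- The translates of the unit ball of `p` by the points of `T` cover the space, have disjoint
interiors, and meet in extreme subsets (faces) only. -/
structure IsBallTiling {E : Type*} [AddCommGroup E] [Module ℝ E] (p : Seminorm ℝ E) (T : Set E) :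
    Prop where
  cover : ∀ x, ∃ t ∈ T, p (x - t) ≤ 1
  two_le : ∀ t ∈ T, ∀ u ∈ T, t ≠ u → 2 ≤ p (u - t)
  isExtreme : ∀ t ∈ T, ∀ u ∈ T, t ≠ u → IsExtreme ℝ {x | p x ≤ 1} (commonFace p (u - t))

/-- `t` is the translation carrying the unit ball of `p` to a ball that touches it along a whole edge:
the common part is a face with at least two points. -/
structure IsFacetVector {E : Type*} [AddCommGroup E] [Module ℝ E] (p : Seminorm ℝ E) (t : E) :
    Prop where
  two_le : 2 ≤ p t
  exists_ne : ∃ x ∈ commonFace p t, x ≠ (1 / 2 : ℝ) • t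
  isExtreme : IsExtreme ℝ {x | p x ≤ 1} (commonFace p t)

section CommonFace

variable {E : Type*} [AddCommGroup E] [Module ℝ E] {p : Seminorm ℝ E}

lemma sub_mem_commonFace {t x : E} (hx : x ∈ commonFace p t) : t - x ∈ commonFace p t := by
  refine ⟨?_, ?_⟩
  · rw [← map_neg_eq_map, neg_sub]; exact hx.2
  · rw [sub_sub_cancel_left, map_neg_eq_map]; exact hx.1

lemma convex_commonFace (t : E) : Convex ℝ (commonFace p t) := by
  have h := (p.convex_closedBall 0 1).inter (p.convex_closedBall t 1)
  convert h using 1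
  ext x
  simp [commonFace, Seminorm.mem_closedBall]

lemma half_smul_mem_commonFace {t x : E} (hx : x ∈ commonFace p t) :
    (1 / 2 : ℝ) • t ∈ commonFace p t := by
  have := convex_commonFace t hx (sub_mem_commonFace hx) (show (0 : ℝ) ≤ 1 / 2 by norm_num)
    (show (0 : ℝ) ≤ 1 / 2 by norm_num) (by norm_num)
  convert this using 1
  module

lemma neg_mem_commonFace_neg {t x : E} (hx : x ∈ commonFace p t) : -x ∈ commonFace p (-t) := by
  refine ⟨?_, ?_⟩
  · rw [map_neg_eq_map]; exact hx.1
  · rw [show -x - -t = -(x - t) by abel, map_neg_eq_map]; exact hx.2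

lemma neg_mem_commonFace_neg_iff {t x : E} : -x ∈ commonFace p (-t) ↔ x ∈ commonFace p t :=
  ⟨fun h => by simpa using neg_mem_commonFace_neg h, neg_mem_commonFace_neg⟩

lemma IsFacetVector.neg {t : E} (ht : IsFacetVector p t) : IsFacetVector p (-t) where
  two_le := by rw [map_neg_eq_map]; exact ht.two_le
  exists_ne := by
    obtain ⟨x, hx, hne⟩ := ht.exists_ne
    refine ⟨-x, neg_mem_commonFace_neg hx, fun h => hne ?_⟩
    rwa [smul_neg, neg_inj] at h
  isExtreme := by
    refine ⟨fun x hx => hx.1, fun x hx y hy z hz hzs => ?_⟩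
    rw [← neg_neg x, neg_mem_commonFace_neg_iff]
    refine ht.isExtreme.left_mem_of_mem_openSegment (x := -x) (y := -y) (z := -z) ?_ ?_ ?_ ?_
    · simpa using hx
    · simpa using hy
    · rw [← neg_mem_commonFace_neg_iff, neg_neg]; exact hz
    · obtain ⟨a, b, ha, hb, hab, rfl⟩ := hzs
      exact ⟨a, b, ha, hb, hab, by module⟩

lemma IsFacetVector.half_smul_mem {t : E} (ht : IsFacetVector p t) :
    (1 / 2 : ℝ) • t ∈ commonFace p t :=
  let ⟨_, hx, _⟩ := ht.exists_ne
  half_smul_mem_commonFace hx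

lemma IsFacetVector.map_eq_two {t : E} (ht : IsFacetVector p t) : p t = 2 := by
  refine le_antisymm ?_ ht.two_le
  have := ht.half_smul_mem.1
  rw [map_smul_eq_mul] at this
  norm_num at this
  linarith

/-- A functional norming `t` equals `1` on the common face of the unit ball and its translate
by `t`. -/
lemma eq_one_of_mem_commonFace {t x : E} {f : E →ₗ[ℝ] ℝ} (hf : ∀ x, |f x| ≤ p x) (ht : 2 ≤ p t)
    (hft : f t = p t) (hx : x ∈ commonFace p t) : f x = 1 := by
  have h1 := (le_abs_self _).trans (hf x)
  have h2 := (neg_le_abs _).trans (hf (x - t))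
  rw [map_sub] at h2
  linarith [hx.1, hx.2]

end CommonFace

section Plane

variable {E : Type*} [NormedAddCommGroup E] [NormedSpace ℝ E] {p : Seminorm ℝ E}

lemma exists_norming_functional (hp : Continuous p) {v : E} (hv : 0 < p v) :
    ∃ f : E →ₗ[ℝ] ℝ, (∀ x, |f x| ≤ p x) ∧ f v = p v := by
  have hopen : IsOpen (p.ball 0 1) := by
    have : p.ball 0 1 = {x | p x < 1} := by ext x; simp [Seminorm.mem_ball]
    rw [this]
    exact isOpen_lt hp continuous_const
  obtain ⟨f, hf⟩ := geometric_hahn_banach_open_point (p.convex_ball 0 1) hopen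
    (x := (p v)⁻¹ • v) (by
      rw [Seminorm.mem_ball_zero, map_smul_eq_mul, norm_inv, Real.norm_of_nonneg hv.le,
        inv_mul_cancel₀ hv.ne']
      exact lt_irrefl _)
  set c := f ((p v)⁻¹ • v) with hc
  have hc0 : 0 < c := by
    have := hf 0 (by simp [Seminorm.mem_ball])
    rwa [map_zero] at this
  have hfv : f v = c * p v := by
    rw [hc, map_smul, smul_eq_mul]; field_simp
  have key : ∀ x, f x ≤ c * p x := by
    intro x
    refine le_of_forall_gt_imp_ge_of_dense fun r hr => ?_
    have hr0 : 0 < r / c := div_pos ((mul_nonneg hc0.le (apply_nonneg p x)).trans_lt hr) hc0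
    have hx : p x < r / c := by rwa [lt_div_iff₀ hc0, mul_comm]
    have := hf ((r / c)⁻¹ • x) (by
      rw [Seminorm.mem_ball_zero, map_smul_eq_mul, norm_inv, Real.norm_of_nonneg hr0.le,
        inv_mul_lt_iff₀ hr0, mul_one]
      exact hx)
    rw [map_smul, smul_eq_mul, inv_mul_lt_iff₀ hr0, div_mul_cancel₀ _ hc0.ne'] at this
    exact this.le
  refine ⟨c⁻¹ • (f : E →ₗ[ℝ] ℝ), fun x => ?_, ?_⟩
  · rw [LinearMap.smul_apply, smul_eq_mul, ContinuousLinearMap.coe_coe, abs_mul,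
      abs_of_pos (inv_pos.2 hc0), inv_mul_le_iff₀ hc0, abs_le]
    refine ⟨?_, key x⟩
    have := key (-x)
    rw [map_neg, map_neg_eq_map] at this
    linarith
  · rw [LinearMap.smul_apply, smul_eq_mul, ContinuousLinearMap.coe_coe, hfv,
      inv_mul_cancel_left₀ hc0.ne']

/-- In the plane, the midpoint of an edge lies on no other proper face: a ball touching the unit ball in a
face through the midpoint of the edge with facet vector `t` is the translate by `t`. The two faces lie
on a line and contain each other, so they have the same centre. -/
lemma IsFacetVector.eq_of_half_smul_mem (hp : Continuous p) (hp0 : ∀ x, p x = 0 → x = 0)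
    (hE : Module.finrank ℝ E = 2) {t m : E} (ht : IsFacetVector p t) (hm : 2 ≤ p m)
    (hme : IsExtreme ℝ {x | p x ≤ 1} (commonFace p m))
    (h : (1 / 2 : ℝ) • t ∈ commonFace p m) : m = t := by
  have hsub : ∀ x ∈ commonFace p t, x ∈ commonFace p m := fun x hx =>
    hme.left_mem_of_mem_openSegment hx.1 (sub_mem_commonFace hx).1 h
      ⟨1 / 2, 1 / 2, by norm_num, by norm_num, by norm_num, by module⟩
  obtain ⟨q, hq, hqt⟩ := ht.exists_ne
  obtain ⟨f, hf, hfm⟩ := exists_norming_functional hp (v := m) (by linarith)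
  have hf1 : ∀ x ∈ commonFace p m, f x = 1 := fun x hx => eq_one_of_mem_commonFace hf hm hfm hx
  have : Module.Finite ℝ E := Module.finite_of_finrank_eq_succ hE
  have hker : Module.finrank ℝ (LinearMap.ker f) = 1 := by
    have h1 := f.finrank_range_add_finrank_ker
    have h2 : LinearMap.range f = ⊤ := by
      rw [LinearMap.range_eq_top]
      refine LinearMap.surjective fun h0 => ?_
      rw [h0, LinearMap.zero_apply] at hfm
      linarith
    rw [h2, hE, finrank_top, Module.finrank_self] at h1
    omega
  have hsup : ∀ z ∈ commonFace p m, z ∈ commonFace p t := by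
    intro z hz
    obtain ⟨c, hc⟩ : ∃ c : ℝ, c • (q - (1 / 2 : ℝ) • t) = z - (1 / 2 : ℝ) • t := by
      have hq' : q - (1 / 2 : ℝ) • t ∈ LinearMap.ker f := by
        rw [LinearMap.mem_ker, map_sub, hf1 _ (hsub q hq), hf1 _ h, sub_self]
      have hz' : z - (1 / 2 : ℝ) • t ∈ LinearMap.ker f := by
        rw [LinearMap.mem_ker, map_sub, hf1 _ hz, hf1 _ h, sub_self]
      obtain ⟨c, hc⟩ := (finrank_eq_one_iff_of_nonzero' (⟨_, hq'⟩ : LinearMap.ker f)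
        (fun h0 => hqt (sub_eq_zero.1 (congrArg Subtype.val h0)))).1 hker ⟨_, hz'⟩
      exact ⟨c, congrArg Subtype.val hc⟩
    have hz1 : z = (1 / 2 : ℝ) • t + c • (q - (1 / 2 : ℝ) • t) := by rw [hc]; abel
    rcases le_or_gt |c| 1 with hc1 | hc1
    · rw [abs_le] at hc1
      have := convex_commonFace t hq (sub_mem_commonFace hq)
        (show 0 ≤ (1 + c) / 2 by linarith) (show 0 ≤ (1 - c) / 2 by linarith) (by ring)
      convert this using 1
      rw [hz1]; module
    · -- A point of the line beyond the edge contradicts that the edge is a face.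
      rcases lt_abs.1 hc1 with hc1 | hc1
      · refine ht.isExtreme.left_mem_of_mem_openSegment hz.1 h.1 hq
          ⟨c⁻¹, 1 - c⁻¹, by positivity, ?_, by ring, ?_⟩
        · have := inv_lt_one_of_one_lt₀ hc1
          linarith
        · have hc0 : c ≠ 0 := by positivity
          rw [hz1, smul_add, smul_smul c⁻¹ c, inv_mul_cancel₀ hc0]; module
      · refine ht.isExtreme.left_mem_of_mem_openSegment hz.1 h.1 (sub_mem_commonFace hq)
          ⟨(-c)⁻¹, 1 - (-c)⁻¹, inv_pos.2 (by linarith), ?_, by ring, ?_⟩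
        · have := inv_lt_one_of_one_lt₀ hc1
          linarith
        · have hc0 : c ≠ 0 := by intro h0; simp [h0] at hc1; linarith
          have : (-c)⁻¹ * c = -1 := by field_simp
          rw [hz1, smul_add, smul_smul (-c)⁻¹ c, this]; module
  -- The face is invariant under translation by `m - t`, and bounded.
  have hn : ∀ n : ℕ, q + (n : ℝ) • (m - t) ∈ commonFace p t := by
    intro n
    induction n with
    | zero => simpa using hq
    | succ n ih =>
      have := hsup _ (sub_mem_commonFace (hsub _ (sub_mem_commonFace ih)))
      convert this using 1
      push_cast
      module
  have hb : ∀ n : ℕ, n * p (m - t) ≤ 2 := by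
    intro n
    have h1 := map_sub_le_add p (q + (n : ℝ) • (m - t)) q
    rw [add_sub_cancel_left, map_smul_eq_mul, Real.norm_natCast] at h1
    linarith [(hn n).1, hq.1]
  refine sub_eq_zero.1 (hp0 _ ?_)
  by_contra h0
  have hpos : 0 < p (m - t) := lt_of_le_of_ne (apply_nonneg p _) (Ne.symm h0)
  obtain ⟨n, hn⟩ := exists_nat_gt (2 / p (m - t))
  rw [div_lt_iff₀ hpos] at hn
  linarith [hb n]

lemma IsBallTiling.finite_setOf_map_sub_le {T : Set E} (hT : IsBallTiling p T) (hp : Continuous p)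
    (hK : IsCompact {x | p x ≤ 1}) (u : E) (R : ℝ) : {v ∈ T | p (v - u) ≤ R}.Finite := by
  -- The bounded region is covered by finitely many open balls of radius `1`, each of which contains
  -- at most one point of `T`.
  have hcomp : IsCompact {x | p (x - u) ≤ R} := by
    have hR : 0 < |R| + 1 := by positivity
    refine (hK.image (f := fun y => u + (|R| + 1) • y) (by fun_prop)).of_isClosed_subset
      (isClosed_le (hp.comp (by fun_prop)) continuous_const) fun x hx => ?_
    refine ⟨(|R| + 1)⁻¹ • (x - u), ?_, ?_⟩
    · change p _ ≤ 1
      rw [map_smul_eq_mul, norm_inv, Real.norm_of_nonneg hR.le, inv_mul_le_iff₀ hR]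
      linarith [le_abs_self R, show p (x - u) ≤ R from hx]
    · change u + (|R| + 1) • (|R| + 1)⁻¹ • (x - u) = x
      rw [smul_inv_smul₀ hR.ne']; abel
  obtain ⟨s, -, hs⟩ := hcomp.elim_nhds_subcover (fun x => {y | p (y - x) < 1}) fun x _ =>
    (isOpen_lt (hp.comp (by fun_prop)) continuous_const).mem_nhds (by simp)
  have hex : ∀ v ∈ {v ∈ T | p (v - u) ≤ R}, ∃ x ∈ s, p (v - x) < 1 := by
    intro v hv
    simpa using hs hv.2
  choose! g hgs hg using hex
  refine Set.Finite.of_finite_image (f := g)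
    (s.finite_toSet.subset (Set.image_subset_iff.2 fun v hv => hgs v hv)) fun v hv w hw h => ?_
  by_contra hne
  have h1 := hT.two_le v hv.1 w hw.1 hne
  have h2 := map_sub_le_add p (w - g w) (v - g v)
  rw [h, show w - g w - (v - g w) = w - v by abel] at h2
  have h3 := hg w hw
  have h4 := hg v hv
  rw [h] at h4
  linarith

/-- Every boundary point of a tile lies in another tile, as the other tiles form a locally finite
family of closed sets covering the complement. -/
lemma IsBallTiling.exists_ne_mem {T : Set E} (hT : IsBallTiling p T) (hp : Continuous p)
    (hK : IsCompact {x | p x ≤ 1}) {u z : E} (hz : p z = 1) :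
    ∃ v ∈ T, v ≠ u ∧ p (u + z - v) ≤ 1 := by
  have hfin := hT.finite_setOf_map_sub_le hp hK u 3
  have hclosed : IsClosed (⋃ v ∈ {v ∈ T | p (v - u) ≤ 3} \ {u}, {y | p (y - v) ≤ 1}) :=
    (hfin.subset Set.sdiff_subset).isClosed_biUnion fun v _ =>
      isClosed_le (hp.comp (by fun_prop)) continuous_const
  have htend : Filter.Tendsto (fun ε : ℝ => u + (1 + ε) • z) (nhdsWithin 0 (Set.Ioo 0 1))
      (nhds (u + z)) := by
    have : Continuous fun ε : ℝ => u + (1 + ε) • z := by fun_prop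
    simpa using (this.tendsto 0).mono_left nhdsWithin_le_nhds
  have : (nhdsWithin (0 : ℝ) (Set.Ioo 0 1)).NeBot := by
    rw [← mem_closure_iff_nhdsWithin_neBot, closure_Ioo zero_ne_one]
    simp
  have hmem := hclosed.mem_of_tendsto htend (by
    filter_upwards [self_mem_nhdsWithin] with ε hε
    obtain ⟨v, hv, hv1⟩ := hT.cover (u + (1 + ε) • z)
    have hε1 : p ((1 + ε) • z) = 1 + ε := by
      rw [map_smul_eq_mul, hz, mul_one, Real.norm_of_nonneg (by linarith [hε.1])]
    simp only [Set.mem_iUnion]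
    refine ⟨v, ⟨⟨hv, ?_⟩, ?_⟩, hv1⟩
    · have := map_sub_le_add p ((1 + ε) • z) (u + (1 + ε) • z - v)
      rw [show (1 + ε) • z - (u + (1 + ε) • z - v) = v - u by abel] at this
      linarith [hε.2]
    · rintro rfl
      rw [add_sub_cancel_left, hε1] at hv1
      linarith [hε.1])
  simp only [Set.mem_iUnion] at hmem
  obtain ⟨v, ⟨⟨hv, -⟩, hvu⟩, h⟩ := hmem
  exact ⟨v, hv, hvu, h⟩

/-- The tile across an edge is determined by the edge, so a tiling is invariant under the facet
vectors. -/
lemma IsBallTiling.add_mem_of_isFacetVector {T : Set E} (hT : IsBallTiling p T) (hp : Continuous p)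
    (hp0 : ∀ x, p x = 0 → x = 0) (hK : IsCompact {x | p x ≤ 1}) (hE : Module.finrank ℝ E = 2)
    {u t : E} (hu : u ∈ T) (ht : IsFacetVector p t) : u + t ∈ T := by
  have hz : p ((1 / 2 : ℝ) • t) = 1 := by
    rw [map_smul_eq_mul, ht.map_eq_two]; norm_num
  obtain ⟨v, hv, hvu, h⟩ := hT.exists_ne_mem hp hK (u := u) hz
  have := ht.eq_of_half_smul_mem hp hp0 hE (hT.two_le u hu v hv hvu.symm)
    (hT.isExtreme u hu v hv hvu.symm) ⟨hz.le, by
      rwa [show (1 / 2 : ℝ) • t - (v - u) = u + (1 / 2 : ℝ) • t - v by abel]⟩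
  rw [← this, add_sub_cancel]
  exact hv

lemma IsBallTiling.add_mem_of_mem_span {T : Set E} (hT : IsBallTiling p T) (hp : Continuous p)
    (hp0 : ∀ x, p x = 0 → x = 0) (hK : IsCompact {x | p x ≤ 1}) (hE : Module.finrank ℝ E = 2)
    {u m : E} (hu : u ∈ T) (hm : m ∈ Submodule.span ℤ {t | IsFacetVector p t}) : u + m ∈ T := by
  rw [← Submodule.mem_toAddSubgroup, Submodule.span_int_eq_addSubgroupClosure] at hm
  induction hm using AddSubgroup.closure_induction'' generalizing u with
  | zero => rwa [add_zero]
  | mem t ht => exact hT.add_mem_of_isFacetVector hp hp0 hK hE hu ht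
  | neg_mem t ht => exact hT.add_mem_of_isFacetVector hp hp0 hK hE hu ht.neg
  | add x y _ _ hx hy => rw [← add_assoc]; exact hy (hx hu)

/-- The lattice generated by the facet vectors is generated by two vectors, since it is discrete. -/
lemma IsBallTiling.exists_generators {T : Set E} (hT : IsBallTiling p T) (hp : Continuous p)
    (hp0 : ∀ x, p x = 0 → x = 0) (hK : IsCompact {x | p x ≤ 1}) (hE : Module.finrank ℝ E = 2) :
    ∃ e₁ ∈ Submodule.span ℤ {t | IsFacetVector p t}, ∃ e₂ ∈ Submodule.span ℤ {t | IsFacetVector p t},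
      ∀ m ∈ Submodule.span ℤ {t | IsFacetVector p t}, ∃ i j : ℤ, m = i • e₁ + j • e₂ := by
  obtain ⟨u, hu, -⟩ := hT.cover 0
  set L := Submodule.span ℤ {t | IsFacetVector p t} with hL
  have hmin : ∀ m ∈ L, m ≠ 0 → 2 ≤ p m := by
    intro m hm hm0
    have := hT.two_le u hu _ (hT.add_mem_of_mem_span hp hp0 hK hE hu hm) (by simpa using hm0)
    rwa [add_sub_cancel_left] at this
  have hdisc : DiscreteTopology L := by
    refine discreteTopology_iff_isOpen_singleton_zero.2 ?_
    have : ({0} : Set L) = {m : L | p (m : E) < 2} := by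
      ext m
      constructor
      · rintro rfl
        simp
      · intro h
        by_contra hne
        exact absurd (hmin m m.2 fun h0 => hne (Subtype.ext h0)) (not_le.2 h)
    rw [this]
    exact isOpen_lt (hp.comp continuous_subtype_val) continuous_const
  have : Module.Finite ℝ E := Module.finite_of_finrank_eq_succ hE
  have hrank : Module.finrank ℤ L ≤ 2 := by
    have h1 := Real.finrank_eq_int_finrank_of_discrete hdisc
    have h2 := Submodule.finrank_le (Submodule.span ℝ {t : E | IsFacetVector p t})
    rw [hE] at h2
    exact h1.symm.le.trans h2
  -- The basis has at most two elements; it is padded with zeros.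
  let b := Module.finBasis ℤ L
  let e : ℕ → E := fun k => if h : k < Module.finrank ℤ L then (b ⟨k, h⟩ : E) else 0
  have he : ∀ k, e k ∈ L := by
    intro k
    by_cases h : k < Module.finrank ℤ L
    · simp only [e, h, dif_pos]; exact (b ⟨k, h⟩).2
    · simp only [e, h, dif_neg, not_false_eq_true]; exact L.zero_mem
  refine ⟨e 0, he 0, e 1, he 1, fun m hm => ?_⟩
  let c : ℕ → ℤ := fun k => if h : k < Module.finrank ℤ L then b.repr ⟨m, hm⟩ ⟨k, h⟩ else 0
  refine ⟨c 0, c 1, ?_⟩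
  have h1 : m = ∑ k : Fin (Module.finrank ℤ L), c k • e k := by
    have := congrArg (Subtype.val) (b.sum_repr ⟨m, hm⟩)
    simp only [Submodule.coe_sum, Submodule.coe_smul] at this
    rw [← this]
    refine Finset.sum_congr rfl fun k _ => ?_
    simp [c, e]
  rw [h1, Fin.sum_univ_eq_sum_range (fun k => c k • e k),
    Finset.sum_subset (Finset.range_subset_range.2 hrank) fun k _ hk => ?_, Finset.sum_range_succ,
    Finset.sum_range_one]
  simp [e, Finset.mem_range.not.1 hk]

/-- Two facet vectors that are congruent modulo twice the lattice agree up to sign: otherwise half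
their difference would be a centre of a tile containing the midpoint of an edge. -/
lemma IsBallTiling.eq_or_eq_neg_of_sub_eq_two_smul {T : Set E} (hT : IsBallTiling p T)
    (hp : Continuous p) (hp0 : ∀ x, p x = 0 → x = 0) (hK : IsCompact {x | p x ≤ 1})
    (hE : Module.finrank ℝ E = 2) {s t m : E} (hs : IsFacetVector p s) (ht : IsFacetVector p t)
    (hm : m ∈ Submodule.span ℤ {t | IsFacetVector p t}) (h : t - s = (2 : ℝ) • m) :
    s = t ∨ s = -t := by
  obtain ⟨u, hu, -⟩ := hT.cover 0
  have hum := hT.add_mem_of_mem_span hp hp0 hK hE hu hm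
  by_cases hm0 : m = 0
  · left
    rw [hm0, smul_zero, sub_eq_zero] at h
    exact h.symm
  · right
    have hne : u ≠ u + m := by simpa using fun h => hm0 h
    have h1 := hT.two_le u hu _ hum hne
    have h2 := hT.isExtreme u hu _ hum hne
    rw [add_sub_cancel_left] at h1 h2
    have : m = t := by
      refine ht.eq_of_half_smul_mem hp hp0 hE h1 h2 ⟨ht.half_smul_mem.1, ?_⟩
      have e : (1 / 2 : ℝ) • t - m = (1 / 2 : ℝ) • s := by
        rw [show t = s + (2 : ℝ) • m by rw [← h]; abel]; module
      rw [e]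
      exact hs.half_smul_mem.1
    rw [this, sub_eq_iff_eq_add, ← sub_eq_iff_eq_add', two_smul] at h
    rw [← h]; abel

lemma IsBallTiling.ne_two_smul {T : Set E} (hT : IsBallTiling p T)
    (hp : Continuous p) (hp0 : ∀ x, p x = 0 → x = 0) (hK : IsCompact {x | p x ≤ 1})
    (hE : Module.finrank ℝ E = 2) {t m : E} (ht : IsFacetVector p t)
    (hm : m ∈ Submodule.span ℤ {t | IsFacetVector p t}) : t ≠ (2 : ℝ) • m := by
  rintro rfl
  obtain ⟨u, hu, -⟩ := hT.cover 0
  have h1 := ht.map_eq_two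
  rw [map_smul_eq_mul] at h1
  norm_num at h1
  have h2 := hT.two_le u hu _ (hT.add_mem_of_mem_span hp hp0 hK hE hu hm) (by
    intro h
    have : m = 0 := by simpa using h
    simp [this] at h1)
  rw [add_sub_cancel_left] at h2
  linarith

/-- A plane norm whose unit ball tiles face-to-face is the maximum of the absolute values of three
linear functionals. There is one for each nonzero class of facet vectors modulo twice the lattice; they
give the norm at every point that does not point towards a vertex, hence everywhere by continuity. -/
theorem IsBallTiling.exists_functionals {T : Set E} (hT : IsBallTiling p T)
    (hp : Continuous p) (hp0 : ∀ x, p x = 0 → x = 0) (hK : IsCompact {x | p x ≤ 1})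
    (hE : Module.finrank ℝ E = 2) :
    ∃ g : Fin 3 → E →ₗ[ℝ] ℝ, (∀ i x, |g i x| ≤ p x) ∧ ∀ x, ∃ i, |g i x| = p x := by
  obtain ⟨e₁, he₁, e₂, he₂, hgen⟩ := hT.exists_generators hp hp0 hK hE
  have hclass : ∀ c : ZMod 2 × ZMod 2, ∃ g : E →ₗ[ℝ] ℝ, (∀ x, |g x| ≤ p x) ∧ ∀ i j : ℤ,
      ((i : ZMod 2), (j : ZMod 2)) = c → IsFacetVector p (i • e₁ + j • e₂) →
      ∀ x ∈ commonFace p (i • e₁ + j • e₂), |g x| = 1 := by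
    intro c
    -- A class without facet vectors is served by the zero functional.
    by_cases hc : ∃ i j : ℤ, ((i : ZMod 2), (j : ZMod 2)) = c ∧ IsFacetVector p (i • e₁ + j • e₂)
    · obtain ⟨i, j, rfl, hij⟩ := hc
      obtain ⟨g, hg, hgt⟩ := exists_norming_functional hp (v := i • e₁ + j • e₂)
        (by linarith [hij.two_le])
      refine ⟨g, hg, fun i' j' hc hij' x hx => ?_⟩
      rw [Prod.mk.injEq, ZMod.intCast_eq_intCast_iff_dvd_sub,
        ZMod.intCast_eq_intCast_iff_dvd_sub] at hc
      obtain ⟨⟨k, hk⟩, ⟨l, hl⟩⟩ := hc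
      push_cast at hk hl
      have hsub : (i • e₁ + j • e₂) - (i' • e₁ + j' • e₂) = (2 : ℝ) • (k • e₁ + l • e₂) := by
        rw [show i = i' + 2 * k by linarith, show j = j' + 2 * l by linarith]
        module
      rcases hT.eq_or_eq_neg_of_sub_eq_two_smul hp hp0 hK hE hij' hij
        (add_mem (Submodule.smul_mem _ _ he₁) (Submodule.smul_mem _ _ he₂)) hsub with h | h
      · rw [h] at hx
        rw [eq_one_of_mem_commonFace hg hij.two_le hgt hx, abs_one]
      · rw [h] at hx
        have := neg_mem_commonFace_neg hx
        rw [neg_neg] at this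
        rw [← abs_neg, ← map_neg, eq_one_of_mem_commonFace hg hij.two_le hgt this, abs_one]
    · exact ⟨0, by simp, fun i j h1 h2 => absurd ⟨i, j, h1, h2⟩ hc⟩
  choose g hg hg1 using hclass
  have : Module.Finite ℝ E := Module.finite_of_finrank_eq_succ hE
  have hgc : ∀ c, Continuous (g c) := fun c => LinearMap.continuous_of_finiteDimensional _
  obtain ⟨u, hu, -⟩ := hT.cover 0
  let A : Set E := (fun v => v - u) '' {v ∈ T | p (v - u) ≤ 2}
  have hA : A.Finite := (hT.finite_setOf_map_sub_le hp hK u 2).image _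
  have hdense : Dense (⋂ v ∈ A, ((Submodule.span ℝ {v} : Submodule ℝ E) : Set E)ᶜ) := by
    refine dense_biInter_of_isOpen (fun v _ => ?_) hA.countable fun v _ => ?_
    · exact (Submodule.closed_of_finiteDimensional _).isOpen_compl
    · rw [← interior_eq_empty_iff_dense_compl, Set.eq_empty_iff_forall_notMem]
      intro x hx
      have h1 := Submodule.eq_top_of_nonempty_interior' _ ⟨x, hx⟩
      have h2 := finrank_span_le_card (R := ℝ) ({v} : Set E)
      rw [h1, finrank_top, hE] at h2
      simp at h2
  let S : Set E := {x | ∃ i : Fin 3, |g (![(1, 0), (0, 1), (1, 1)] i) x| = p x}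
  have hS : IsClosed S := by
    have : S = ⋃ i : Fin 3, {x | |g (![(1, 0), (0, 1), (1, 1)] i) x| = p x} := by
      ext x; simp [S]
    rw [this]
    exact isClosed_iUnion_of_finite fun i => isClosed_eq ((hgc _).abs) hp
  refine ⟨fun i => g (![(1, 0), (0, 1), (1, 1)] i), fun i x => hg _ x, fun x => ?_⟩
  have hsub : (⋂ v ∈ A, ((Submodule.span ℝ {v} : Submodule ℝ E) : Set E)ᶜ) ⊆ S := by
    intro x hx
    simp only [Set.mem_iInter, Set.mem_compl_iff, SetLike.mem_coe] at hx
    by_cases hx0 : p x = 0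
    · exact ⟨0, by simp [hp0 x hx0]⟩
    have hpx : 0 < p x := lt_of_le_of_ne (apply_nonneg p x) (Ne.symm hx0)
    set y := (p x)⁻¹ • x with hy
    have hxy : x = p x • y := by rw [hy, smul_inv_smul₀ hx0]
    have hpy : p y = 1 := by
      rw [hy, map_smul_eq_mul, norm_inv, Real.norm_of_nonneg hpx.le, inv_mul_cancel₀ hx0]
    obtain ⟨v, hv, hvu, hyv⟩ := hT.exists_ne_mem hp hK (u := u) hpy
    have hmem : y ∈ commonFace p (v - u) :=
      ⟨hpy.le, by rwa [show y - (v - u) = u + y - v by abel]⟩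
    have hle : p (v - u) ≤ 2 := by
      have := map_sub_le_add p y (y - (v - u))
      rw [sub_sub_cancel] at this
      linarith [hmem.1, hmem.2]
    have hfacet : IsFacetVector p (v - u) := by
      -- The point `x` is not a multiple of `v - u`, so `y` is not the midpoint `(v - u) / 2`.
      refine ⟨hT.two_le u hu v hv hvu.symm, ⟨y, hmem, fun h => ?_⟩, hT.isExtreme u hu v hv hvu.symm⟩
      refine hx _ ⟨v, ⟨hv, hle⟩, rfl⟩ ?_
      rw [hxy, h, smul_smul]
      exact Submodule.smul_mem _ _ (Submodule.mem_span_singleton_self _)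
    obtain ⟨i, j, hij⟩ := hgen _ (Submodule.subset_span hfacet)
    rw [hij] at hfacet hmem
    have hne : ((i : ZMod 2), (j : ZMod 2)) ≠ 0 := by
      intro h0
      rw [Prod.mk_eq_zero, ZMod.intCast_zmod_eq_zero_iff_dvd,
        ZMod.intCast_zmod_eq_zero_iff_dvd] at h0
      obtain ⟨⟨k, hk⟩, ⟨l, hl⟩⟩ := h0
      refine hT.ne_two_smul hp hp0 hK hE hfacet
        (add_mem (Submodule.smul_mem _ k he₁) (Submodule.smul_mem _ l he₂)) ?_
      push_cast at hk hl
      rw [hk, hl]; module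
    have hcases : ∀ c : ZMod 2 × ZMod 2, c ≠ 0 → ∃ i : Fin 3, ![(1, 0), (0, 1), (1, 1)] i = c := by
      decide
    obtain ⟨k, hk⟩ := hcases _ hne
    refine ⟨k, ?_⟩
    rw [hk, hxy, map_smul, smul_eq_mul, abs_mul, hg1 _ i j rfl hfacet y hmem, ← hxy, mul_one,
      abs_of_pos hpx]
  have : x ∈ closure S := hdense.mono hsub x
  rwa [hS.closure_eq] at this

end Plane

/-! ### The normal form of the norm -/

lemma hexGauge_half_eq {a b : ℝ} (ha : 0 ≤ a) (hb : 0 ≤ b) (hab : a + b ≤ 1) (v : ℝ × ℝ) :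
    hexGauge (1 / 2) (1 / 2) v = hexGauge a b v := by
  have key : ∀ a b : ℝ, 0 ≤ a → 0 ≤ b → a + b ≤ 1 → hexGauge a b v = max |v.1| |v.2| := by
    intro a b ha hb hab
    have h1 := abs_add_le (a * v.1) (b * v.2)
    rw [abs_mul, abs_mul, abs_of_nonneg ha, abs_of_nonneg hb] at h1
    rw [hexGauge, ← max_assoc, max_eq_left]
    refine h1.trans ?_
    nlinarith [le_max_left |v.1| |v.2|, le_max_right |v.1| |v.2|, abs_nonneg v.1]
  rw [key a b ha hb hab, key _ _ (by norm_num) (by norm_num) (by norm_num)]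

/-- A plane norm that is the maximum of three linear functionals is a hexagonal norm. The functionals
satisfy a linear relation with, after a choice of signs, nonnegative coefficients; the two functionals
with the smaller coefficients serve as coordinates. When these coefficients add up to less than the
third one, the third functional is redundant and the norm is a maximum norm. -/
theorem exists_equiv_hexGauge {E : Type*} [AddCommGroup E] [Module ℝ E] {p : Seminorm ℝ E}
    (hp0 : ∀ x, p x = 0 → x = 0) (hE : Module.finrank ℝ E = 2) {g : Fin 3 → E →ₗ[ℝ] ℝ}
    (hg : ∀ i x, |g i x| ≤ p x) (hg' : ∀ x, ∃ i, |g i x| = p x) :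
    ∃ a b : ℝ, 0 < b ∧ b ≤ a ∧ a ≤ 1 ∧ 1 ≤ a + b ∧
      ∃ φ : E ≃ₗ[ℝ] ℝ × ℝ, ∀ x, p x = hexGauge a b (φ x) := by
  have : Module.Finite ℝ E := Module.finite_of_finrank_eq_succ hE
  obtain ⟨c, hc, i₀, hi₀⟩ : ∃ c : Fin 3 → ℝ, ∑ i, c i • g i = 0 ∧ ∃ i, c i ≠ 0 := by
    refine Fintype.not_linearIndependent_iff.1 fun h => ?_
    have := h.fintype_card_le_finrank
    rw [Module.finrank_linearMap, hE] at this
    simp at this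
  let σ := Tuple.sort fun i => |c i|
  have hmono : Monotone ((fun i => |c i|) ∘ σ) := Tuple.monotone_sort _
  obtain ⟨d, h, hd, hd0, hh, hrel, hd0'⟩ : ∃ (d : Fin 3 → ℝ) (h : Fin 3 → E →ₗ[ℝ] ℝ), Monotone d ∧
      (∀ i, 0 ≤ d i) ∧ (∀ i x, |h i x| = |g (σ i) x|) ∧ ∑ i, d i • h i = 0 ∧ d 2 ≠ 0 := by
    refine ⟨(fun i => |c i|) ∘ σ, fun i => if 0 ≤ c (σ i) then g (σ i) else -g (σ i), hmono,
      fun i => abs_nonneg _, ?_, ?_, ?_⟩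
    · intro i x
      dsimp only
      split_ifs <;> simp
    · rw [← hc, ← Equiv.sum_comp σ fun i => c i • g i]
      refine Finset.sum_congr rfl fun i _ => ?_
      simp only [Function.comp_apply]
      split_ifs with h
      · rw [abs_of_nonneg h]
      · rw [abs_of_neg (not_le.1 h), smul_neg, neg_smul, neg_neg]
    · intro h2
      have h3 : |c i₀| ≤ 0 := by
        have := hmono (Fin.le_last (σ.symm i₀))
        rw [show Fin.last 2 = 2 from rfl, h2] at this
        simpa using this
      exact hi₀ (abs_nonpos_iff.1 h3)
  have hle : ∀ i x, |h i x| ≤ p x := fun i x => (hh i x).le.trans (hg _ x)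
  have hd2 : 0 < d 2 := lt_of_le_of_ne (hd0 2) (Ne.symm hd0')
  have h2 : ∀ x, h 2 x = -(d 1 / d 2 * h 1 x + d 0 / d 2 * h 0 x) := by
    intro x
    have := LinearMap.congr_fun hrel x
    simp only [Fin.sum_univ_three, LinearMap.add_apply, LinearMap.smul_apply, smul_eq_mul,
      LinearMap.zero_apply] at this
    field_simp
    linarith
  have hpx : ∀ x, p x = hexGauge (d 1 / d 2) (d 0 / d 2) (h 1 x, h 0 x) := by
    intro x
    refine le_antisymm ?_ (hexGauge_le_iff.2 ⟨hle 1 x, hle 0 x, ?_⟩)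
    · obtain ⟨i, hi⟩ := hg' x
      rw [← σ.apply_symm_apply i, ← hh] at hi
      rw [← hi]
      obtain ⟨k1, k0, k2⟩ := hexGauge_le_iff.1
        (le_refl (hexGauge (d 1 / d 2) (d 0 / d 2) (h 1 x, h 0 x)))
      rw [← abs_neg, ← h2] at k2
      generalize σ.symm i = k
      fin_cases k
      exacts [k0, k1, k2]
    · have := hle 2 x
      rwa [h2, abs_neg] at this
  have hinj : Function.Injective ((h 1).prod (h 0)) := by
    rw [injective_iff_map_eq_zero]
    intro x hx
    refine hp0 x ?_
    rw [hpx, show (h 1 x, h 0 x) = (0, 0) from hx]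
    simp [hexGauge]
  let φ : E ≃ₗ[ℝ] ℝ × ℝ := LinearEquiv.ofBijective _ ⟨hinj,
    (LinearMap.injective_iff_surjective_of_finrank_eq_finrank (by simp [hE])).1 hinj⟩
  have hφ : ∀ x, φ x = (h 1 x, h 0 x) := fun x => rfl
  have hba : d 0 / d 2 ≤ d 1 / d 2 := div_le_div_of_nonneg_right (hd (by decide)) hd2.le
  have ha1 : d 1 / d 2 ≤ 1 := (div_le_one hd2).2 (hd (by decide))
  rcases le_or_gt (d 1 / d 2 + d 0 / d 2) 1 with hab | hab
  · refine ⟨1 / 2, 1 / 2, by norm_num, le_rfl, by norm_num, by norm_num, φ, fun x => ?_⟩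
    rw [hexGauge_half_eq (div_nonneg (hd0 1) hd2.le) (div_nonneg (hd0 0) hd2.le) hab, hpx, hφ]
  · exact ⟨_, _, by linarith, hba, ha1, hab.le, φ, fun x => by rw [hpx, hφ]⟩

/-! ### Parallelohedra in the plane -/

theorem isBallTiling_gaugeSeminorm {E : Type*} [NormedAddCommGroup E] [NormedSpace ℝ E]
    {P T : Set E} (hbal : Balanced ℝ P) (hconv : Convex ℝ P) (habs : Absorbent ℝ P)
    (hclosed : IsClosed P) (h0 : P ∈ nhds 0) (hT : IsFaceToFaceTiling P T) :
    IsBallTiling (gaugeSeminorm hbal hconv habs) T := by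
  have hle : ∀ x, gaugeSeminorm hbal hconv habs x ≤ 1 ↔ x ∈ P := fun x =>
    (gauge_le_one_iff_mem_closure hconv h0).trans (by rw [hclosed.closure_eq])
  have hmem : ∀ t x, x ∈ t +ᵥ P ↔ x - t ∈ P := fun t x => by
    rw [Set.mem_vadd_set_iff_neg_vadd_mem, vadd_eq_add, neg_add_eq_sub]
  refine ⟨fun x => ?_, fun t ht u hu hne => ?_, fun t ht u hu hne => ?_⟩
  · have hx : x ∈ ⋃ t ∈ T, (t +ᵥ P) := hT.cover ▸ Set.mem_univ x
    simp only [Set.mem_iUnion, hmem, exists_prop] at hx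
    simpa only [hle] using hx
  · by_contra! h
    -- The midpoint of the two centres would be interior to both tiles.
    have hlt : gaugeSeminorm hbal hconv habs ((1 / 2 : ℝ) • (u - t)) < 1 := by
      rw [map_smul_eq_mul, Real.norm_of_nonneg (by norm_num)]
      linarith
    have h1 : (1 / 2 : ℝ) • (u - t) ∈ interior P := (gauge_lt_one_iff_mem_interior hconv h0).1 hlt
    rw [← map_neg_eq_map] at hlt
    have h2 : -((1 / 2 : ℝ) • (u - t)) ∈ interior P :=
      (gauge_lt_one_iff_mem_interior hconv h0).1 hlt
    refine Set.disjoint_left.1 (hT.disjoint_interior t ht u hu hne)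
      (Set.vadd_mem_vadd_set (a := t) h1) ?_
    have e : t +ᵥ (1 / 2 : ℝ) • (u - t) = u +ᵥ -((1 / 2 : ℝ) • (u - t)) := by
      simp only [vadd_eq_add]; module
    rw [e]
    exact Set.vadd_mem_vadd_set h2
  · have hext := (hT.common_face t ht u hu hne).1.isExtreme
    have hcf : ∀ x, x ∈ commonFace (gaugeSeminorm hbal hconv habs) (u - t) ↔
        t + x ∈ (t +ᵥ P) ∩ (u +ᵥ P) := by
      intro x
      rw [Set.mem_inter_iff, hmem, hmem, add_sub_cancel_left,
        show t + x - u = x - (u - t) by abel, ← hle, ← hle]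
      rfl
    refine ⟨fun x hx => hx.1, fun x hx y hy z hz hzs => ?_⟩
    rw [hcf] at hz ⊢
    refine hext.left_mem_of_mem_openSegment (y := t + y) ?_ ?_ hz ?_
    · rw [hmem, add_sub_cancel_left, ← hle]; exact hx
    · rw [hmem, add_sub_cancel_left, ← hle]; exact hy
    · exact (mem_openSegment_translate ℝ t).2 hzs

theorem mainTheorem6 (P : Set (EuclideanSpace ℝ (Fin 2))) (hP : IsParallelohedron P)
    (hsymm : ∀ x ∈ P, -x ∈ P) :
    (unitDistanceGraph P hsymm).chromaticNumber = 4 := by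
  obtain ⟨⟨s, hs, hPs⟩, ⟨x₀, hx₀⟩, T, hT⟩ := hP
  have hcomp : IsCompact P := hPs ▸ hs.isCompact_convexHull ℝ
  have hconv : Convex ℝ P := hPs ▸ convex_convexHull ℝ s
  have h0 : P ∈ nhds 0 := by
    rw [mem_interior_iff_mem_nhds.symm]
    have hneg : -x₀ ∈ interior P := by
      have hsub : -interior P ⊆ interior P := interior_maximal
        (fun x hx => by simpa using hsymm _ (interior_subset hx)) isOpen_interior.neg
      exact hsub (by simpa using hx₀)
    have := hconv.interior hx₀ hneg (show (0 : ℝ) ≤ 1 / 2 by norm_num)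
      (show (0 : ℝ) ≤ 1 / 2 by norm_num) (by norm_num)
    simpa using this
  have habs : Absorbent ℝ P := absorbent_nhds_zero h0
  have hbal : Balanced ℝ P := (balanced_iff_neg_mem hconv).2 fun x hx => hsymm x hx
  have htil := isBallTiling_gaugeSeminorm hbal hconv habs hcomp.isClosed h0 hT
  set p := gaugeSeminorm hbal hconv habs with hp
  have hpc : Continuous p := continuous_gauge hconv h0
  have hp0 : ∀ x, p x = 0 → x = 0 := fun x =>
    (gauge_eq_zero habs (NormedSpace.isVonNBounded_of_isBounded ℝ hcomp.isBounded)).1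
  have hK : IsCompact {x | p x ≤ 1} := by
    have : {x | p x ≤ 1} = P := by
      ext x
      refine (gauge_le_one_iff_mem_closure hconv h0).trans ?_
      rw [hcomp.isClosed.closure_eq]
    rwa [this]
  have hE : Module.finrank ℝ (EuclideanSpace ℝ (Fin 2)) = 2 := finrank_euclideanSpace_fin
  obtain ⟨g, hg, hg'⟩ := htil.exists_functionals hpc hp0 hK hE
  obtain ⟨a, b, hb, hba, ha1, hab, φ, hφ⟩ := exists_equiv_hexGauge hp0 hE hg hg'
  have hadj : ∀ x y, (unitDistanceGraph P hsymm).Adj x y ↔ hexGauge a b (φ x - φ y) = 1 := by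
    intro x y
    rw [← map_sub, ← hφ]
    rfl
  refine SimpleGraph.chromaticNumber_eq_iff_colorable_not_colorable (n := 3) |>.2 ⟨?_, ?_⟩
  · obtain ⟨c, hc⟩ := exists_coloring_of_hexGauge hb hba ha1 hab
    exact (SimpleGraph.Coloring.mk (fun x => c (φ x))
      fun {x y} h => hc _ _ ((hadj x y).1 h)).colorable
  · rintro ⟨C⟩
    refine not_exists_three_coloring_of_hexGauge hb hba ha1 hab (fun v => C (φ.symm v))
      fun u v h => C.valid ((hadj _ _).2 ?_)
    simpa using h
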